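/- Let $D$ be an integral domain with quotient field $K$. Assume that $D$ is rad-colon coherent, i.e. for every $x\in K\setminus D$ there is a finitely generated ideal $I$ of $D$ with $\mathrm{rad}(I)=\mathrm{rad}((D:_Dx))$, where $(D:_Dx)=\{d\in D\mid dx\in D\}$. Notation. For a topological space $X$, the inverse topology on $X$ is the topology having the compact open subsets of $X$ as a basis of closed sets; $\mathcal{X}(X)$ is the set of nonempty subsets of $X$ that are closed in the inverse topology, endowed with the topology having as a basis of open sets the sets $\{Y\in\mathcal{X}(X)\mid Y\subseteq\Omega\}$, where $\Omega$ ranges over the compact open subsets of $X$. Put $\mathcal{X}(D):=\mathcal{X}(\mathrm{Spec}(D))$. For a nonempty $\Delta\subseteq\mathrm{Spec}(D)$, $s_\Delta$ is the spectral semistar operation $I\mapsto I^{s_\Delta}:=\bigcap_{P\in\Delta}ID_P$ on the $D$-submodules $I$ of $K$. $\mathrm{Over}_{\mathrm{sloc}}(D)$ is the set of sublocalizations of $D$, i.e. of the subrings of $K$ that are intersections of localizations $D_P$ ($P\in\mathrm{Spec}(D)$), with the topology having as a basis of open sets the sets $\{T\mid x_1,\ldots,x_n\in T\}$ for $x_1,\ldots,x_n\in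 K$. For $D$-submodules $A,B$ of $K$ put $(A:B):=\{x\in K\mid xB\subseteq A\}$. Put $I^v:=(D:(D:I))$ for nonzero $I$, and $0^v:=0$; put $I^t:=\bigcup\{J^v\mid J\subseteq I\text{ a finitely generated }D\text{-submodule}\}$; and let $\mathrm{QSpec}^t(D)$ be the set of prime ideals $P$ of $D$ with $P=P^t$, with the subspace topology of $\mathrm{Spec}(D)$. Let $\pi_s$ be the map $\star\mapsto D^\star$ from the finite-type spectral semistar operations on $D$ to $\mathrm{Over}_{\mathrm{sloc}}(D)$ (every $s_\Delta$ with $\Delta\in\mathcal{X}(D)$ is of finite type), and let $$\pi_t\colon\mathcal{X}(\mathrm{QSpec}^t(D))\longrightarrow\mathrm{Over}_{\mathrm{sloc}}(D),\qquad \Delta\longmapsto D^{s_\Delta}=\bigcap_{P\in\Delta}D_P.$$ Then the following are equivalent: (i) $\pi_t$ is a homeomorphism; (ii) $\pi_t$ is injective; (iii) if $\Delta,\Lambda\in\mathcal{X}(D)$ are such that $\pi_s(s_\Delta)=\pi_s(s_\Lambda)$, then $\Delta\cap\mathrm{QSpec}^t(D)=\Lambda\cap\mathrm{QSpec}^t(D)$.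 -/

import Mathlib

open scoped Topology Pointwise

namespace Subloc

/-! ### The inverse topology and the space of its nonempty closed subsets -/

section InverseTopology

variable (X : Type*) [TopologicalSpace X]

/-- The inverse topology on `X`: the compact open subsets of `X` form a basis of closed sets. -/
@[reducible]
def inverseTopology : TopologicalSpace X :=
  TopologicalSpace.generateFrom {V | ∃ U : Set X, IsOpen U ∧ IsCompact U ∧ V = Uᶜ}

/-- The set of all nonempty subsets of `X` that are closed in the inverse topology. -/
def InvClosed : Type _ :=
  {Y : Set X // Y.Nonempty ∧ IsClosed[inverseTopology X] Y}

/-- The topology on `InvClosed X` with the sets `{Y | Y ⊆ Ω}` as a basis of open sets, where `Ω`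
ranges over the compact open subsets of `X`. -/
instance : TopologicalSpace (InvClosed X) :=
  TopologicalSpace.generateFrom
    {𝒰 | ∃ Ω : Set X, IsOpen Ω ∧ IsCompact Ω ∧ 𝒰 = {Y : InvClosed X | Y.1 ⊆ Ω}}

variable {X}

theorem isCompact_of_isClosed_inverseTopology [SpectralSpace X] {Y : Set X}
    (hY : IsClosed[inverseTopology X] Y) : IsCompact Y := by
  have hle : constructibleTopology X ≤ inverseTopology X := by
    refine le_generateFrom ?_
    rintro V ⟨U, hU, hUc, rfl⟩
    exact IsCompact.isOpen_constructibleTopology_of_isClosed (by simpa using hUc)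
      hU.isClosed_compl
  have hle' : constructibleTopology X ≤ (inferInstance : TopologicalSpace X) := by
    refine le_of_le_of_eq (le_generateFrom fun U hU => ?_)
      (PrespectralSpace.isTopologicalBasis (X := X)).eq_generateFrom.symm
    exact hU.2.isOpen_constructibleTopology_of_isOpen hU.1
  have h1 : IsClosed[constructibleTopology X] Y := hY.mono hle
  have h2 : IsClosed (WithTopology.ofTopology ⁻¹' Y : Set (WithConstructibleTopology X)) := by
    rw [WithConstructibleTopology.isClosed_iff]
    exact h1
  have h3 := h2.isCompact
  have hcont : Continuous (WithTopology.ofTopology : WithConstructibleTopology X → X) := by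
    refine ⟨fun U hU => ?_⟩
    rw [WithConstructibleTopology.isOpen_iff]
    exact hle' U hU
  have h4 := h3.image hcont
  convert! h4
  ext y
  constructor
  · intro hy
    exact ⟨WithTopology.toTopology _ y, hy, rfl⟩
  · rintro ⟨z, hz, rfl⟩
    exact hz

end InverseTopology

theorem mem_biInf {D K ι : Type*} [CommRing D] [Field K] [Algebra D K] {Δ : Set ι}
    {f : ι → Submodule D K} {x : K} : x ∈ ⨅ P ∈ Δ, f P ↔ ∀ P ∈ Δ, x ∈ f P := by
  simp [Submodule.mem_iInf]

section Domain

variable (D K : Type*) [CommRing D] [IsDomain D] [Field K] [Algebra D K] [IsFractionRing D K]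

/-! ### Overrings -/

/-- The overrings of `D`: the rings between `D` and its quotient field `K`. -/
def Overring : Type _ := Subalgebra D K

/-- The Zariski topology on the overrings of `D`. -/
instance : TopologicalSpace (Overring D K) :=
  TopologicalSpace.generateFrom
    {𝒰 | ∃ F : Finset K, 𝒰 = {T : Overring D K | ∀ x ∈ F, x ∈ (show Subalgebra D K from T)}}

variable {D}

/-- The localization `D_P` inside `K`. -/
noncomputable def locAt (P : PrimeSpectrum D) : Subalgebra D K :=
  Localization.subalgebra.ofField K P.asIdeal.primeCompl P.asIdeal.primeCompl_le_nonZeroDivisors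

variable (D)

/-- The space of sublocalizations of `D`, i.e. of the overrings that are intersections of
localizations of `D` at prime ideals, as a subspace of the space of overrings. (The empty
intersection is `K`, which is also the localization at the zero ideal.) -/
def Sublocalization : Type _ :=
  {T : Overring D K // ∃ Δ : Set (PrimeSpectrum D), T = (⨅ P ∈ Δ, locAt K P : Subalgebra D K)}

instance : TopologicalSpace (Sublocalization D K) :=
  inferInstanceAs (TopologicalSpace {T : Overring D K //
    ∃ Δ : Set (PrimeSpectrum D), T = (⨅ P ∈ Δ, locAt K P : Subalgebra D K)})

variable {K} in
/-- The ideal `(D :_D x) = {d ∈ D | d x ∈ D}`. -/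
def colonIdeal (x : K) : Ideal D :=
  Submodule.comap (LinearMap.toSpanSingleton D K x) (1 : Submodule D K)

/-- `D` is rad-colon coherent: for every `x ∈ K \ D` the ideal `(D :_D x)` has the same radical as some finitely generated ideal of `D`. -/
def IsRadColonCoherent : Prop :=
  ∀ x : K, x ∉ Set.range (algebraMap D K) →
    ∃ I : Ideal D, I.FG ∧ I.radical = (colonIdeal D x).radical

/-! ### Semistar operations -/

/-- A semistar operation on `D`. -/
@[ext]
structure SemistarOperation where
  /-- the underlying map `I ↦ I^⋆` on the `D`-submodules of `K` -/
  star : Submodule D K → Submodule D K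
  le_star : ∀ I, I ≤ star I
  star_star : ∀ I, star (star I) = star I
  star_mono : ∀ I J, I ≤ J → star I ≤ star J
  smul_star : ∀ (x : K) (I : Submodule D K), x • star I = star (x • I)

variable {D K}

/-- The map `I ↦ ⋃ {J^⋆ | J ⊆ I finitely generated}`. -/
def finiteTypeClosure (star : Submodule D K → Submodule D K) (I : Submodule D K) : Set K :=
  ⋃ J ∈ {J : Submodule D K | J ≤ I ∧ J.FG}, (star J : Set K)

/-- A semistar operation is of finite type if `⋆ = ⋆_f`. -/
def SemistarOperation.IsFiniteType (s : SemistarOperation D K) : Prop :=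
  ∀ I : Submodule D K, (s.star I : Set K) = finiteTypeClosure s.star I

theorem mem_mul_locAt {I : Submodule D K} {P : PrimeSpectrum D} {x : K} :
    x ∈ I * Subalgebra.toSubmodule (locAt K P) ↔ ∃ s ∉ P.asIdeal, s • x ∈ I := by
  constructor
  · intro hx
    refine Submodule.mul_induction_on hx ?_ ?_
    · rintro m hm _ ⟨a, s, hs, rfl⟩
      refine ⟨s, hs, ?_⟩
      have hs0 : algebraMap D K s ≠ 0 := by
        intro h
        rw [FaithfulSMul.algebraMap_eq_zero_iff] at h
        exact hs (h ▸ P.asIdeal.zero_mem)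
      have : s • (m * (algebraMap D K a * (algebraMap D K s)⁻¹)) = a • m := by
        rw [Algebra.smul_def, Algebra.smul_def]
        field_simp
      rw [this]
      exact I.smul_mem a hm
    · rintro y z ⟨s, hs, hy⟩ ⟨t, ht, hz⟩
      refine ⟨s * t, fun h => (P.2.mem_or_mem h).elim hs ht, ?_⟩
      rw [smul_add]
      refine I.add_mem ?_ ?_
      · rw [mul_comm, mul_smul]
        exact I.smul_mem t hy
      · rw [mul_smul]
        exact I.smul_mem s hz
  · rintro ⟨s, hs, hx⟩
    have hs0 : algebraMap D K s ≠ 0 := by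
      intro h
      rw [FaithfulSMul.algebraMap_eq_zero_iff] at h
      exact hs (h ▸ P.asIdeal.zero_mem)
    have : x = s • x * (algebraMap D K 1 * (algebraMap D K s)⁻¹) := by
      rw [Algebra.smul_def, map_one]
      field_simp
    rw [this]
    exact Submodule.mul_mem_mul hx ⟨1, s, hs, rfl⟩

variable (K) in
/-- The spectral semistar operation `s_Δ : I ↦ ⋂ {I D_P | P ∈ Δ}`, for `Δ` nonempty. -/
noncomputable def spectralOp (Δ : Set (PrimeSpectrum D)) (hΔ : Δ.Nonempty) :
    SemistarOperation D K where
  star I := ⨅ P ∈ Δ, I * Subalgebra.toSubmodule (locAt K P)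
  le_star I := by
    refine le_iInf₂ fun P _ x hx => ?_
    exact mem_mul_locAt.2 ⟨1, fun h => P.2.ne_top ((Ideal.eq_top_iff_one _).2 h), by rwa [one_smul]⟩
  star_star I := by
    refine le_antisymm ?_ ?_
    · refine le_iInf₂ fun P hP x hx => ?_
      obtain ⟨s, hs, hsx⟩ := mem_mul_locAt.1 (mem_biInf.1 hx P hP)
      obtain ⟨t, ht, htx⟩ := mem_mul_locAt.1 (mem_biInf.1 hsx P hP)
      refine mem_mul_locAt.2 ⟨t * s, fun h => (P.2.mem_or_mem h).elim ht hs, ?_⟩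
      rwa [mul_smul]
    · refine le_iInf₂ fun P _ x hx => ?_
      exact mem_mul_locAt.2 ⟨1, fun h => P.2.ne_top ((Ideal.eq_top_iff_one _).2 h), by rwa [one_smul]⟩
  star_mono I J h := iInf₂_mono fun P _ => mul_le_mul' h le_rfl
  smul_star x I := by
    obtain ⟨P₀, hP₀⟩ := hΔ
    ext y
    rw [Submodule.mem_smul_pointwise_iff_exists, mem_biInf]
    simp only [mem_biInf, mem_mul_locAt, Submodule.mem_smul_pointwise_iff_exists]
    constructor
    · rintro ⟨z, hz, rfl⟩ P hP
      obtain ⟨s, hs, h⟩ := hz P hP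
      exact ⟨s, hs, s • z, h, smul_comm _ _ _⟩
    · intro h
      by_cases hx : x = 0
      · obtain ⟨s, hs, b, hb, h0⟩ := h P₀ hP₀
        refine ⟨0, fun P hP => ⟨1, fun h => P.2.ne_top ((Ideal.eq_top_iff_one _).2 h), by simp⟩, ?_⟩
        have hs0 : s ≠ 0 := fun h => hs (h ▸ P₀.asIdeal.zero_mem)
        rw [hx, zero_smul, eq_comm, Algebra.smul_def, mul_eq_zero] at h0
        rcases h0 with h0 | h0
        · rw [FaithfulSMul.algebraMap_eq_zero_iff] at h0
          exact absurd h0 hs0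
        · simp [h0]
      · refine ⟨x⁻¹ • y, fun P hP => ?_, smul_inv_smul₀ hx y⟩
        obtain ⟨s, hs, b, hb, h0⟩ := h P hP
        refine ⟨s, hs, ?_⟩
        rw [smul_comm, ← h0, inv_smul_smul₀ hx]
        exact hb

/-- A semistar operation is spectral if it is of the form `s_Δ`. -/
def SemistarOperation.IsSpectral (s : SemistarOperation D K) : Prop :=
  ∃ (Δ : Set (PrimeSpectrum D)) (hΔ : Δ.Nonempty), s = spectralOp K Δ hΔ

theorem isFiniteType_spectralOp {Δ : Set (PrimeSpectrum D)} (hΔ : Δ.Nonempty)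
    (hc : IsCompact Δ) : (spectralOp K Δ hΔ).IsFiniteType := by
  intro I
  ext x
  simp only [finiteTypeClosure, Set.mem_iUnion, Set.mem_ofPred_eq, SetLike.mem_coe]
  constructor
  · intro hx
    have hx' : ∀ P ∈ Δ, ∃ s ∉ P.asIdeal, s • x ∈ I := fun P hP =>
      mem_mul_locAt.1 (mem_biInf.1 hx P hP)
    obtain ⟨t, ht⟩ := hc.elim_finite_subcover
      (fun s : {s : D // s • x ∈ I} => (PrimeSpectrum.basicOpen s.1 : Set (PrimeSpectrum D)))
      (fun s => (PrimeSpectrum.basicOpen s.1).2) (fun P hP => by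
        obtain ⟨s, hs, h⟩ := hx' P hP
        exact Set.mem_iUnion.2 ⟨⟨s, h⟩, hs⟩)
    classical
    refine ⟨Submodule.span D ((t.image fun s => s.1 • x : Finset K) : Set K), ⟨?_, ?_⟩, ?_⟩
    · rw [Submodule.span_le]
      intro y hy
      simp only [Finset.coe_image, Set.mem_image, SetLike.mem_coe] at hy
      obtain ⟨s, -, rfl⟩ := hy
      exact s.2
    · exact ⟨_, rfl⟩
    · refine mem_biInf.2 fun P hP => mem_mul_locAt.2 ?_
      obtain ⟨s, hs⟩ := Set.mem_iUnion.1 (ht hP)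
      obtain ⟨hst, hsP⟩ := Set.mem_iUnion.1 hs
      refine ⟨s.1, hsP, Submodule.subset_span ?_⟩
      simp only [Finset.coe_image, Set.mem_image, SetLike.mem_coe]
      exact ⟨s, hst, rfl⟩
  · rintro ⟨J, ⟨hJ, -⟩, hx⟩
    exact (spectralOp K Δ hΔ).star_mono _ _ hJ hx

/-- The overring `D^⋆` of `D`. -/
def SemistarOperation.overring (s : SemistarOperation D K) : Subalgebra D K where
  carrier := s.star 1
  add_mem' := fun ha hb => (s.star 1).add_mem ha hb
  algebraMap_mem' := fun r =>
    s.le_star 1 (Submodule.mem_one.2 ⟨r, rfl⟩)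
  mul_mem' := by
    intro a b ha hb
    have h1 : a • (1 : Submodule D K) ≤ s.star 1 := by
      intro y hy
      obtain ⟨z, hz, rfl⟩ := (Submodule.mem_smul_pointwise_iff_exists _ _ _).1 hy
      obtain ⟨r, rfl⟩ := Submodule.mem_one.1 hz
      rw [smul_eq_mul, mul_comm, ← Algebra.smul_def]
      exact (s.star 1).smul_mem r ha
    have h2 := s.star_mono _ _ h1
    rw [s.star_star, ← s.smul_star] at h2
    exact h2 (Submodule.smul_mem_pointwise_smul b a _ hb)

theorem overring_spectralOp (Δ : Set (PrimeSpectrum D)) (hΔ : Δ.Nonempty) :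
    (spectralOp K Δ hΔ).overring = ⨅ P ∈ Δ, locAt K P := by
  ext x
  change x ∈ (⨅ P ∈ Δ, 1 * Subalgebra.toSubmodule (locAt K P) : Submodule D K) ↔ _
  simp [Algebra.mem_iInf, Submodule.mem_iInf]

variable (D K)

/-- The spectral semistar operations of finite type. -/
def SpectralFiniteType : Type _ :=
  {s : SemistarOperation D K // s.IsSpectral ∧ s.IsFiniteType}

variable {D}

/-- The map `π_s : ⋆ ↦ D^⋆` from the finite-type spectral semistar operations to the
sublocalizations. -/
def piS (s : SpectralFiniteType D K) : Sublocalization D K :=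
  ⟨s.1.overring, by
    obtain ⟨⟨Δ, hΔ, h⟩, -⟩ := s.2
    exact ⟨Δ, by rw [h]; exact overring_spectralOp Δ hΔ⟩⟩

/-- For `Δ` nonempty and closed in the inverse topology of `Spec D`, the finite-type spectral
operation `s_Δ`. -/
noncomputable def spectralOpInvClosed (Δ : InvClosed (PrimeSpectrum D)) :
    SpectralFiniteType D K :=
  ⟨spectralOp K Δ.1 Δ.2.1, ⟨Δ.1, Δ.2.1, rfl⟩,
    isFiniteType_spectralOp Δ.2.1 (isCompact_of_isClosed_inverseTopology Δ.2.2)⟩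

/-! ### The `t`-operation -/

variable {K}

open Classical in
/-- The divisorial closure `I^v = (D : (D : I))`, where `(A : B) = {x ∈ K | x B ⊆ A}`. The zero
ideal is fixed, as by every star operation (the axiom `x I^⋆ = (x I)^⋆` with `x = 0` gives
`0^⋆ = 0`); the formula itself yields this whenever `D` is not a field. -/
noncomputable def vClosure (I : Submodule D K) : Submodule D K :=
  if I = ⊥ then ⊥ else 1 / (1 / I)

/-- The `t`-operation `t = v_f`. -/
def tClosure (I : Submodule D K) : Set K := finiteTypeClosure vClosure I

variable (D K)

/-- The `t`-spectrum of `D`: the set of the prime ideals `P` with `P = P^t`. -/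
def tSpectrum : Set (PrimeSpectrum D) :=
  {P | (IsLocalization.coeSubmodule K P.asIdeal : Set K) =
    tClosure (IsLocalization.coeSubmodule K P.asIdeal)}

variable {D}

/-- The map `π_t : Δ ↦ D^{s_Δ}` from the nonempty inverse-closed subsets of the `t`-spectrum (with
the subspace topology from `Spec D`) to the sublocalizations. -/
noncomputable def piT (Δ : InvClosed (tSpectrum D K)) : Sublocalization D K :=
  ⟨(spectralOp K (Subtype.val '' Δ.1) (Δ.2.1.image _)).overring,
    ⟨Subtype.val '' Δ.1, overring_spectralOp _ _⟩⟩

end Domain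

end Subloc

namespace Subloc

/-! ### Inverse-closed and constructibly closed subsets of a spectral space. -/

section ConstructibleSets

variable {X : Type*} [TopologicalSpace X]

/-! Taking traces `Δ ↦ Δ ∩ QSpec^t` carries `π_s` to `π_t` (`piT_trace`): if `x ∉ D_P`, a prime
minimal over `(D :_D x)` and below `P` is a `t`-prime whose localization still omits `x`. Every
inverse-closed subset of the `t`-spectrum is such a trace (`trace_closure`), so injectivity of `π_t`
is condition (iii); this needs no coherence.

Rad-colon coherence makes `{P | x ∈ D_P}` compact open, whence `π_t` is continuous, and surjective
with section `T ↦ {P ∈ QSpec^t | T ⊆ D_P}`. If `π_t` is injective, this section is its inverse. The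
inverse is continuous because the `t`-spectrum is constructibly closed: by compactness, whether
these primes all lie in a given compact open set is already forced by finitely many elements of `T`.
-/

theorem compactSpace_constructibleTopology [SpectralSpace X] :
    @CompactSpace X (constructibleTopology X) :=
  @Function.Surjective.compactSpace _ _ _ (constructibleTopology X) _
    (WithTopology.continuous_ofTopology _) _ (WithTopology.ofTopology_surjective _)

theorem constructibleTopology_le [PrespectralSpace X] :
    constructibleTopology X ≤ (inferInstance : TopologicalSpace X) :=
  le_of_le_of_eq (le_generateFrom fun _ hU => hU.2.isOpen_constructibleTopology_of_isOpen hU.1)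
    (PrespectralSpace.isTopologicalBasis (X := X)).eq_generateFrom.symm

theorem isClosed_constructibleTopology_of_isOpen {U : Set X} (hU : IsOpen U) (hUc : IsCompact U) :
    IsClosed[constructibleTopology X] U :=
  @IsClosed.mk _ (constructibleTopology X) _
    (IsCompact.isOpen_constructibleTopology_of_isClosed (by simpa using hUc) hU.isClosed_compl)

theorem isCompact_of_isClosed_constructibleTopology [SpectralSpace X] {Z : Set X}
    (hZ : IsClosed[constructibleTopology X] Z) : IsCompact Z := by
  have h : @IsCompact X (constructibleTopology X) Z :=
    @IsClosed.isCompact X (constructibleTopology X) _ compactSpace_constructibleTopology hZ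
  have h' := @IsCompact.image X X (constructibleTopology X) _ Z id h
    (continuous_id_of_le constructibleTopology_le)
  rwa [Set.image_id] at h'

/-- A family of constructibly closed sets whose intersection lies in a compact open set has a
finite subfamily with the same property. -/
theorem exists_finset_iInter_subset [SpectralSpace X] {ι : Type*} {Z : Set X} {f : ι → Set X}
    {U : Set X} (hZ : IsClosed[constructibleTopology X] Z)
    (hf : ∀ i, IsClosed[constructibleTopology X] (f i)) (hU : IsOpen U) (hUc : IsCompact U)
    (h : Z ∩ ⋂ i, f i ⊆ U) : ∃ t : Finset ι, Z ∩ ⋂ i ∈ t, f i ⊆ U := by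
  have hUo : IsClosed[constructibleTopology X] Uᶜ :=
    @IsOpen.isClosed_compl X (constructibleTopology X) _
      (hUc.isOpen_constructibleTopology_of_isOpen hU)
  -- Constructible compactness of `Z \ U`, on which the `f i` have empty intersection.
  obtain ⟨t, ht⟩ := @IsCompact.elim_finite_subfamily_closed X (constructibleTopology X) _ _
    (@IsClosed.isCompact X (constructibleTopology X) _ compactSpace_constructibleTopology
      (@IsClosed.inter X _ _ (constructibleTopology X) hZ hUo)) f hf (by
    refine Set.eq_empty_of_forall_notMem ?_
    rintro p ⟨⟨hp, hpU⟩, hpf⟩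
    exact hpU (h ⟨hp, hpf⟩))
  refine ⟨t, fun p hp => ?_⟩
  by_contra hpU
  have hmem : p ∈ Z ∩ Uᶜ ∩ ⋂ i ∈ t, f i := ⟨⟨hp.1, hpU⟩, hp.2⟩
  rw [ht] at hmem
  exact hmem

/-- A set closed in the inverse topology is an intersection of compact open sets. -/
theorem isClosed_inverseTopology_iff {Y : Set X} :
    IsClosed[inverseTopology X] Y ↔
      ∀ p ∉ Y, ∃ U : Set X, IsOpen U ∧ IsCompact U ∧ Y ⊆ U ∧ p ∉ U := by
  have hb := TopologicalSpace.isTopologicalBasis_of_subbasis_of_inter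
    (t := inverseTopology X) (r := {V | ∃ U : Set X, IsOpen U ∧ IsCompact U ∧ V = Uᶜ}) rfl (by
      rintro _ ⟨U, hU, hUc, rfl⟩ _ ⟨V, hV, hVc, rfl⟩
      exact ⟨U ∪ V, hU.union hV, hUc.union hVc, (Set.compl_union _ _).symm⟩)
  rw [← @isOpen_compl_iff X Y (inverseTopology X),
    @TopologicalSpace.IsTopologicalBasis.isOpen_iff X (inverseTopology X) _ _ hb]
  refine forall₂_congr fun p _ => ⟨?_, ?_⟩
  · rintro ⟨V, rfl | ⟨U, hU, hUc, rfl⟩, hp, hV⟩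
    -- The basis built from the subbasis also contains the whole space.
    · have : Y = ∅ := by simpa using hV
      exact ⟨∅, isOpen_empty, isCompact_empty, this.le, Set.notMem_empty p⟩
    · exact ⟨U, hU, hUc, Set.compl_subset_compl.1 hV, hp⟩
  · rintro ⟨U, hU, hUc, hYU, hp⟩
    exact ⟨Uᶜ, Or.inr ⟨U, hU, hUc, rfl⟩, hp, Set.compl_subset_compl.2 hYU⟩

theorem exists_isCompact_preimage_val [PrespectralSpace X] {Q : Set X} {V : Set Q}
    (hV : IsOpen V) (hVc : IsCompact V) :
    ∃ U : Set X, IsOpen U ∧ IsCompact U ∧ V = Subtype.val ⁻¹' U := by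
  obtain ⟨O, hO, rfl⟩ := isOpen_induced_iff.1 hV
  obtain ⟨W, hWc, hWo, h1, h2⟩ := PrespectralSpace.exists_isCompact_and_isOpen_between
    (hVc.image continuous_subtype_val) hO (Set.image_preimage_subset _ _)
  exact ⟨W, hWo, hWc, (Set.image_subset_iff.1 h1).antisymm (Set.preimage_mono h2)⟩

/-- `Q ∩ U` is constructibly closed, and such sets are compact in the original, coarser topology. -/
theorem isCompact_preimage_val [SpectralSpace X] {Q : Set X}
    (hQ : IsClosed[constructibleTopology X] Q) {U : Set X} (hU : IsOpen U) (hUc : IsCompact U) :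
    IsCompact (Subtype.val ⁻¹' U : Set Q) := by
  rw [Subtype.isCompact_iff, Subtype.image_preimage_coe]
  exact isCompact_of_isClosed_constructibleTopology
    (@IsClosed.inter X _ _ (constructibleTopology X) hQ
      (isClosed_constructibleTopology_of_isOpen hU hUc))

/-- The inverse-closed subsets of a constructibly closed set are its intersections with
inverse-closed sets. -/
theorem isClosed_inverseTopology_val_iff [SpectralSpace X] {Q : Set X}
    (hQ : IsClosed[constructibleTopology X] Q) {Y : Set Q} :
    IsClosed[inverseTopology Q] Y ↔
      ∀ p ∉ Y, ∃ U : Set X, IsOpen U ∧ IsCompact U ∧ Subtype.val '' Y ⊆ U ∧ p.1 ∉ U := by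
  rw [isClosed_inverseTopology_iff]
  refine forall₂_congr fun p _ => ⟨?_, ?_⟩
  · rintro ⟨V, hV, hVc, hYV, hp⟩
    obtain ⟨U, hU, hUc, rfl⟩ := exists_isCompact_preimage_val hV hVc
    exact ⟨U, hU, hUc, Set.image_subset_iff.2 hYV, hp⟩
  · rintro ⟨U, hU, hUc, hYU, hp⟩
    exact ⟨_, hU.preimage continuous_subtype_val, isCompact_preimage_val hQ hU hUc,
      Set.image_subset_iff.1 hYU, hp⟩

end ConstructibleSets

end Subloc

namespace Subloc

/-! ### The `t`-spectrum and the primes minimal over colon ideals. -/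

section TSpectrum

set_option linter.unusedSectionVars false

variable {D K : Type*} [CommRing D] [IsDomain D] [Field K] [Algebra D K] [IsFractionRing D K]

theorem mem_colonIdeal {x : K} {d : D} :
    d ∈ colonIdeal D x ↔ ∃ r : D, algebraMap D K r = algebraMap D K d * x := by
  rw [colonIdeal, Submodule.mem_comap, Submodule.mem_one, LinearMap.toSpanSingleton_apply,
    Algebra.smul_def]

theorem mem_locAt_iff {P : PrimeSpectrum D} {x : K} :
    x ∈ locAt K P ↔ ∃ s ∉ P.asIdeal, s ∈ colonIdeal D x := by
  have h := mem_mul_locAt (I := (1 : Submodule D K)) (P := P) (x := x)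
  rw [one_mul] at h
  exact h

theorem le_vClosure (I : Submodule D K) : I ≤ vClosure I := by
  unfold vClosure
  split_ifs with h
  · exact h.le
  · intro y hy
    rw [Submodule.mem_div_iff_forall_mul_mem]
    intro z hz
    rw [mul_comm]
    exact hz y hy

theorem vClosure_le_one {I : Submodule D K} (hI : I ≤ 1) : vClosure I ≤ 1 := by
  unfold vClosure
  split_ifs with h
  · exact bot_le
  · intro y hy
    have := hy 1 (fun z hz => by rw [one_mul]; exact hI hz)
    rwa [mul_one] at this

/-- Submodules of `D` have their `v`-closure in `D`, so `P = P^t` can be tested on ideals and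
elements of `D`. -/
theorem mem_tSpectrum_iff {P : PrimeSpectrum D} :
    P ∈ tSpectrum D K ↔ ∀ (J : Ideal D) (a : D), J.FG →
      algebraMap D K a ∈ vClosure (IsLocalization.coeSubmodule K J) →
        J ≤ P.asIdeal → a ∈ P.asIdeal := by
  have hinj : Function.Injective (algebraMap D K) := IsFractionRing.injective D K
  constructor
  · intro hP J a hJ ha hJP
    have hmem : algebraMap D K a ∈ (IsLocalization.coeSubmodule K P.asIdeal : Set K) := by
      rw [show (IsLocalization.coeSubmodule K P.asIdeal : Set K) = _ from hP]
      exact Set.mem_biUnion (x := IsLocalization.coeSubmodule K J)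
        ⟨IsLocalization.coeSubmodule_mono K hJP,
          (IsLocalization.coeSubmodule_fg K hinj J).2 hJ⟩ ha
    obtain ⟨b, hb, hab⟩ := hmem
    rwa [← hinj hab]
  · intro h
    refine Set.Subset.antisymm ?_ ?_
    · rintro x hx
      refine Set.mem_biUnion (x := Submodule.span D {x}) ⟨?_, Submodule.fg_span_singleton x⟩
        (le_vClosure _ (Submodule.mem_span_singleton_self x))
      rwa [Submodule.span_singleton_le_iff_mem]
    · intro x hx
      obtain ⟨J, ⟨hJP, hJ⟩, hxJ⟩ := Set.mem_iUnion₂.1 hx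
      have hmap : IsLocalization.coeSubmodule K (J.comap (Algebra.linearMap D K)) = J := by
        refine Submodule.map_comap_eq_of_le (hJP.trans ?_)
        rintro _ ⟨r, -, rfl⟩
        exact ⟨r, rfl⟩
      have hJ1 : J ≤ 1 := by
        refine hJP.trans ?_
        rintro _ ⟨r, -, rfl⟩
        exact Submodule.mem_one.2 ⟨r, rfl⟩
      obtain ⟨a, rfl⟩ := Submodule.mem_one.1 (vClosure_le_one hJ1 hxJ)
      refine ⟨a, h (J.comap (Algebra.linearMap D K)) a ?_ ?_ ?_, rfl⟩
      · exact (IsLocalization.coeSubmodule_fg K hinj _).1 (hmap.symm ▸ hJ)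
      · rw [hmap]
        exact hxJ
      · intro b hb
        obtain ⟨c, hc, hcb⟩ := hJP hb
        rwa [← hinj hcb]

/-- Each implication `J ≤ P → a ∈ P` with `J` finitely generated defines the union of a compact open
set and a closed set. -/
theorem isClosed_constructibleTopology_tSpectrum :
    IsClosed[constructibleTopology (PrimeSpectrum D)] (tSpectrum D K) := by
  have key : tSpectrum D K = ⋂ i : {i : Ideal D × D // i.1.FG ∧
      algebraMap D K i.2 ∈ vClosure (IsLocalization.coeSubmodule K i.1)},
      ((PrimeSpectrum.zeroLocus (i.1.1 : Set D))ᶜ ∪ PrimeSpectrum.zeroLocus {i.1.2}) := by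
    ext P
    simp only [mem_tSpectrum_iff, Set.mem_iInter, Set.mem_union, Set.mem_compl_iff,
      PrimeSpectrum.mem_zeroLocus, SetLike.coe_subset_coe, Set.singleton_subset_iff,
      SetLike.mem_coe, ← imp_iff_not_or, Subtype.forall, Prod.forall, and_imp]
  rw [key]
  refine @isClosed_iInter _ _ (constructibleTopology _) _ fun ⟨⟨J, a⟩, hJ, _⟩ =>
    @IsClosed.union _ _ _ (constructibleTopology _) ?_ ?_
  · have := PrimeSpectrum.isCompact_isOpen_iff_ideal.2 ⟨J, hJ, rfl⟩
    exact (isClosed_constructibleTopology_of_isOpen this.2 this.1)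
  · exact (PrimeSpectrum.isClosed_zeroLocus _).mono constructibleTopology_le

/-- Rests on the convention `0^v = 0`; it keeps traces nonempty. -/
theorem bot_mem_tSpectrum : (⊥ : PrimeSpectrum D) ∈ tSpectrum D K := by
  rw [mem_tSpectrum_iff]
  intro J a _ ha hJ
  rw [PrimeSpectrum.asIdeal_bot, le_bot_iff] at hJ
  subst hJ
  rw [vClosure, if_pos (by simp)] at ha
  have := (FaithfulSMul.algebraMap_eq_zero_iff D K).1 ((Submodule.mem_bot D).1 ha)
  rw [this]
  exact zero_mem _

/-- The prime ideals minimal over an ideal `(D :_D x)` are `t`-primes. -/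
theorem mem_tSpectrum_of_mem_minimalPrimes {P : PrimeSpectrum D} {x : K}
    (hP : P.asIdeal ∈ (colonIdeal D x).minimalPrimes) : P ∈ tSpectrum D K := by
  rw [mem_tSpectrum_iff]
  intro J y hJ hy hJP
  by_cases hJ0 : IsLocalization.coeSubmodule K J = ⊥
  · rw [vClosure, if_pos hJ0] at hy
    rw [(FaithfulSMul.algebraMap_eq_zero_iff D K).1 ((Submodule.mem_bot D).1 hy)]
    exact zero_mem _
  rw [vClosure, if_neg hJ0] at hy
  -- `B` is the contraction of `(D :_D x) D_P`. By minimality of `P` the extension has radical `P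
  -- D_P`, so some power of `J` lies in `B`.
  set B : Ideal D := ((colonIdeal D x).map
    (algebraMap D (Localization.AtPrime P.asIdeal))).comap
      (algebraMap D (Localization.AtPrime P.asIdeal)) with hB
  have memB (b : D) : b ∈ B ↔ ∃ s ∉ P.asIdeal, s * b ∈ colonIdeal D x :=
    IsLocalization.algebraMap_mem_map_algebraMap_iff P.asIdeal.primeCompl _ _ _
  have hBP : B ≤ P.asIdeal := by
    intro b hb
    obtain ⟨s, hs, hsb⟩ := (memB b).1 hb
    exact (P.2.mem_or_mem (hP.1.2 hsb)).resolve_left hs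
  have hrad : J ≤ B.radical := by
    rw [hB, ← Ideal.comap_radical,
      IsLocalization.AtPrime.radical_map_of_mem_minimalPrimes
        (Localization.AtPrime P.asIdeal) P.asIdeal _ hP]
    exact hJP.trans Ideal.le_comap_map
  obtain ⟨n, hn⟩ := Ideal.exists_pow_le_of_le_radical_of_fg hrad hJ
  -- As `J` is finitely generated, one `s ∉ P` gives `s c J ⊆ (D :_D x)`. Then `s c x ∈ (D : J)`,
  -- and `y ∈ J^v` yields `s c x y ∈ D`.
  have step (c : D) (hc : ∀ i ∈ J, c * i ∈ B) : c * y ∈ B := by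
    have hs : ∀ (J' : Ideal D), J'.FG → (∀ i ∈ J', c * i ∈ B) →
        ∃ s ∉ P.asIdeal, ∀ i ∈ J', s * (c * i) ∈ colonIdeal D x := by
      intro J' hJ'
      refine Submodule.fg_induction
        (motive := fun J' _ => (∀ i ∈ J', c * i ∈ B) →
          ∃ s ∉ P.asIdeal, ∀ i ∈ J', s * (c * i) ∈ colonIdeal D x) ?_ ?_ J' hJ'
      · intro z hz
        obtain ⟨s, hs, hsz⟩ := (memB _).1 (hz z (Submodule.mem_span_singleton_self z))
        refine ⟨s, hs, fun i hi => ?_⟩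
        obtain ⟨d, rfl⟩ := Submodule.mem_span_singleton.1 hi
        have := (colonIdeal D x).mul_mem_left d hsz
        rw [smul_eq_mul]
        convert this using 1
        ring
      · intro N₁ N₂ _ _ h₁ h₂ h
        obtain ⟨s, hs, hs'⟩ := h₁ fun i hi => h i (Submodule.mem_sup_left hi)
        obtain ⟨t, ht, ht'⟩ := h₂ fun i hi => h i (Submodule.mem_sup_right hi)
        refine ⟨s * t, fun hst => (P.2.mem_or_mem hst).elim hs ht, fun i hi => ?_⟩
        obtain ⟨i₁, hi₁, i₂, hi₂, rfl⟩ := Submodule.mem_sup.1 hi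
        have e : s * t * (c * (i₁ + i₂)) = t * (s * (c * i₁)) + s * (t * (c * i₂)) := by ring
        rw [e]
        exact add_mem (Ideal.mul_mem_left _ _ (hs' i₁ hi₁)) (Ideal.mul_mem_left _ _ (ht' i₂ hi₂))
    obtain ⟨s, hs, hs'⟩ := hs J hJ hc
    refine (memB _).2 ⟨s, hs, mem_colonIdeal.2 ?_⟩
    have hmem : algebraMap D K (s * c) * x ∈ (1 / IsLocalization.coeSubmodule K J :
        Submodule D K) := by
      rw [Submodule.mem_div_iff_forall_mul_mem]
      rintro _ ⟨i, hi, rfl⟩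
      obtain ⟨r, hr⟩ := mem_colonIdeal.1 (hs' i hi)
      refine Submodule.mem_one.2 ⟨r, ?_⟩
      rw [hr, Algebra.linearMap_apply]
      simp only [map_mul]
      ring
    obtain ⟨r, hr⟩ := Submodule.mem_one.1 (hy _ hmem)
    refine ⟨r, ?_⟩
    rw [hr]
    simp only [map_mul]
    ring
  -- The factors `J` of `J ^ m` are replaced by `y` one at a time.
  have main : ∀ (m : ℕ) (c : D), (∀ j ∈ J ^ m, c * j ∈ B) → c * y ^ m ∈ B := by
    intro m
    induction m with
    | zero => exact fun c h => by simpa using h 1 (by simp)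
    | succ m ih =>
      intro c h
      have := ih (c * y) fun j hj => by
        have := step (c * j) fun i hi => by
          rw [mul_assoc]
          exact h _ (by rw [pow_succ]; exact Ideal.mul_mem_mul hj hi)
        convert this using 1
        ring
      convert this using 1
      ring
  have := main n 1 fun j hj => by rw [one_mul]; exact hn hj
  rw [one_mul] at this
  exact P.2.mem_of_pow_mem _ (hBP this)

theorem exists_mem_tSpectrum_le {P : PrimeSpectrum D} {x : K} (hx : x ∉ locAt K P) :
    ∃ L ∈ tSpectrum D K, L ≤ P ∧ x ∉ locAt K L := by
  have hle : colonIdeal D x ≤ P.asIdeal := by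
    intro d hd
    by_contra h
    exact hx (mem_locAt_iff.2 ⟨d, h, hd⟩)
  obtain ⟨L, hL, hLP⟩ := Ideal.exists_minimalPrimes_le hle
  refine ⟨⟨L, hL.1.1⟩, mem_tSpectrum_of_mem_minimalPrimes hL, hLP, fun h => ?_⟩
  obtain ⟨s, hs, hsx⟩ := mem_locAt_iff.1 h
  exact hs (hL.1.2 hsx)

end TSpectrum

end Subloc

namespace Subloc

/-! ### Comparison of `π_s` and `π_t`, and the inverse of `π_t`. -/

section Main

set_option linter.unusedSectionVars false

variable {D K : Type*} [CommRing D] [IsDomain D] [Field K] [Algebra D K] [IsFractionRing D K]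

/-- The underlying subalgebra of a sublocalization. -/
def Sublocalization.toSubalgebra (T : Sublocalization D K) : Subalgebra D K := T.1

theorem Sublocalization.ext_mem {T T' : Sublocalization D K}
    (h : ∀ x, x ∈ T.toSubalgebra ↔ x ∈ T'.toSubalgebra) : T = T' :=
  Subtype.ext (Subalgebra.ext h : T.toSubalgebra = T'.toSubalgebra)

theorem Sublocalization.exists_mem_iff (T : Sublocalization D K) :
    ∃ Δ : Set (PrimeSpectrum D), ∀ x, x ∈ T.toSubalgebra ↔ ∀ P ∈ Δ, x ∈ locAt K P := by
  obtain ⟨Δ, h⟩ := T.2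
  refine ⟨Δ, fun x => ?_⟩
  rw [show T.toSubalgebra = _ from h]
  simp [Algebra.mem_iInf]

theorem mem_piS {Δ : InvClosed (PrimeSpectrum D)} {x : K} :
    x ∈ (piS K (spectralOpInvClosed K Δ)).toSubalgebra ↔ ∀ P ∈ Δ.1, x ∈ locAt K P := by
  rw [show (piS K (spectralOpInvClosed K Δ)).toSubalgebra = _ from
    overring_spectralOp Δ.1 Δ.2.1]
  simp [Algebra.mem_iInf]

theorem mem_piT {Δ : InvClosed (tSpectrum D K)} {x : K} :
    x ∈ (piT K Δ).toSubalgebra ↔ ∀ P ∈ Δ.1, x ∈ locAt K P.1 := by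
  rw [show (piT K Δ).toSubalgebra = _ from
    overring_spectralOp (Subtype.val '' Δ.1) (Δ.2.1.image _)]
  simp [Algebra.mem_iInf]

theorem isOpen_sublocalization (F : Finset K) :
    IsOpen {T : Sublocalization D K | ∀ x ∈ F, x ∈ T.toSubalgebra} :=
  (TopologicalSpace.isOpen_generateFrom_of_mem ⟨F, rfl⟩ :
    IsOpen {T : Overring D K | ∀ x ∈ F, x ∈ (show Subalgebra D K from T)}).preimage
      continuous_subtype_val

theorem continuous_to_sublocalization {Y : Type*} [TopologicalSpace Y]
    {f : Y → Sublocalization D K}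
    (h : ∀ F : Finset K, IsOpen {y | ∀ x ∈ F, x ∈ (f y).toSubalgebra}) : Continuous f := by
  refine continuous_induced_rng.2 (continuous_generateFrom_iff.2 ?_)
  rintro _ ⟨F, rfl⟩
  exact h F

/-! ### Inverse-closed subsets of the spectrum -/

/-- Open sets of the spectrum are stable under passing to smaller primes, hence so are intersections
of compact open sets. -/
theorem isClosed_inverseTopology_inf {Y : Set (PrimeSpectrum D)}
    (hY : IsClosed[inverseTopology (PrimeSpectrum D)] Y) {P L : PrimeSpectrum D} (hP : P ∈ Y)
    (hL : L ≤ P) : L ∈ Y := by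
  by_contra h
  obtain ⟨U, hU, -, hYU, hLU⟩ := isClosed_inverseTopology_iff.1 hY L h
  exact hLU (((PrimeSpectrum.le_iff_specializes L P).1 hL).mem_open hU (hYU hP))

/-- The trace on the `t`-spectrum of an inverse-closed set. -/
def InvClosed.trace (Δ : InvClosed (PrimeSpectrum D)) : InvClosed (tSpectrum D K) :=
  ⟨Subtype.val ⁻¹' Δ.1, by
    obtain ⟨P, hP⟩ := Δ.2.1
    exact ⟨⟨⊥, bot_mem_tSpectrum⟩, isClosed_inverseTopology_inf Δ.2.2 hP bot_le⟩, by
    refine (isClosed_inverseTopology_val_iff isClosed_constructibleTopology_tSpectrum).2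
      fun p hp => ?_
    obtain ⟨U, hU, hUc, hYU, hpU⟩ := isClosed_inverseTopology_iff.1 Δ.2.2 p.1 hp
    exact ⟨U, hU, hUc, (Set.image_preimage_subset _ _).trans hYU, hpU⟩⟩

/-- The `t`-primes below the members of `Δ` lie in `Δ`, and they already detect every `x` outside
the intersection. -/
theorem piT_trace (Δ : InvClosed (PrimeSpectrum D)) :
    piT K Δ.trace = piS K (spectralOpInvClosed K Δ) := by
  refine Sublocalization.ext_mem fun x => ?_
  rw [mem_piT, mem_piS]
  refine ⟨fun h P hP => ?_, fun h P hP => h P.1 hP⟩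
  by_contra hx
  obtain ⟨L, hL, hLP, hxL⟩ := exists_mem_tSpectrum_le hx
  exact hxL (h ⟨L, hL⟩ (isClosed_inverseTopology_inf Δ.2.2 hP hLP))

/-- The inverse closure in the spectrum of an inverse-closed subset of the `t`-spectrum. -/
def InvClosed.closure (Δ : InvClosed (tSpectrum D K)) : InvClosed (PrimeSpectrum D) :=
  ⟨{p | ∀ U : Set (PrimeSpectrum D), IsOpen U → IsCompact U → Subtype.val '' Δ.1 ⊆ U → p ∈ U}, by
    obtain ⟨P, hP⟩ := Δ.2.1
    exact ⟨P.1, fun U _ _ h => h ⟨P, hP, rfl⟩⟩, by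
    refine isClosed_inverseTopology_iff.2 fun p hp => ?_
    simp only [Set.mem_ofPred_eq, not_forall] at hp
    obtain ⟨U, hU, hUc, hΔU, hpU⟩ := hp
    exact ⟨U, hU, hUc, fun q hq => hq U hU hUc hΔU, hpU⟩⟩

/-- A `t`-prime outside `Δ` is separated from it by a compact open subset of the whole spectrum, so
the closure adds no `t`-primes. -/
theorem trace_closure (Δ : InvClosed (tSpectrum D K)) : Δ.closure.trace = Δ := by
  refine Subtype.ext (Set.Subset.antisymm (fun p hp => ?_) fun p hp U _ _ h => h ⟨p, hp, rfl⟩)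
  by_contra h
  obtain ⟨U, hU, hUc, hYU, hpU⟩ :=
    (isClosed_inverseTopology_val_iff isClosed_constructibleTopology_tSpectrum).1 Δ.2.2 p h
  exact hpU (hp U hU hUc hYU)

/-! ### Consequences of rad-colon coherence -/

variable (D) in
/-- The set of the primes `P` with `x ∈ D_P`. -/
def locAtDomain (x : K) : Set (PrimeSpectrum D) := {P | x ∈ locAt K P}

theorem locAtDomain_eq (x : K) :
    locAtDomain D x = (PrimeSpectrum.zeroLocus (colonIdeal D x : Set D))ᶜ := by
  ext P
  simp only [locAtDomain, Set.mem_ofPred_eq, mem_locAt_iff, Set.mem_compl_iff,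
    PrimeSpectrum.mem_zeroLocus, Set.not_subset, SetLike.mem_coe]
  exact exists_congr fun s => and_comm

/-- The complement is `V((D :_D x))`, which depends only on the radical and so is cut out by a
finitely generated ideal. -/
theorem IsRadColonCoherent.isCompact_isOpen (hD : IsRadColonCoherent D K) (x : K) :
    IsCompact (locAtDomain D x) ∧ IsOpen (locAtDomain D x) := by
  by_cases hx : x ∈ Set.range (algebraMap D K)
  · obtain ⟨d, rfl⟩ := hx
    have : locAtDomain D (algebraMap D K d) = Set.univ :=
      Set.eq_univ_of_forall fun P => (locAt K P).algebraMap_mem d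
    rw [this]
    exact ⟨isCompact_univ, isOpen_univ⟩
  · obtain ⟨I, hI, hIx⟩ := hD x hx
    refine PrimeSpectrum.isCompact_isOpen_iff_ideal.2 ⟨I, hI, ?_⟩
    rw [locAtDomain_eq, ← PrimeSpectrum.zeroLocus_radical, hIx, PrimeSpectrum.zeroLocus_radical]

theorem IsRadColonCoherent.isClosed_inverseTopology (hD : IsRadColonCoherent D K) (S : Set K) :
    IsClosed[inverseTopology (PrimeSpectrum D)] (⋂ x ∈ S, locAtDomain D x) := by
  refine isClosed_inverseTopology_iff.2 fun p hp => ?_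
  simp only [Set.mem_iInter, not_forall] at hp
  obtain ⟨x, hx, hpx⟩ := hp
  exact ⟨_, (hD.isCompact_isOpen x).2, (hD.isCompact_isOpen x).1, Set.biInter_subset_of_mem hx, hpx⟩

variable (D) in
theorem bot_mem_locAtDomain (x : K) : (⊥ : PrimeSpectrum D) ∈ locAtDomain D x := by
  obtain ⟨a, b, hb, rfl⟩ := IsFractionRing.div_surjective (A := D) x
  refine mem_locAt_iff.2 ⟨b, nonZeroDivisors.ne_zero hb, mem_colonIdeal.2 ⟨a, ?_⟩⟩
  have : algebraMap D K b ≠ 0 := by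
    rw [Ne, FaithfulSMul.algebraMap_eq_zero_iff]
    exact nonZeroDivisors.ne_zero hb
  field_simp

/-- The largest inverse-closed set of primes whose localizations all contain `S`. -/
def IsRadColonCoherent.invClosed (hD : IsRadColonCoherent D K) (S : Set K) :
    InvClosed (PrimeSpectrum D) :=
  ⟨⋂ x ∈ S, locAtDomain D x, ⟨⊥, Set.mem_iInter₂.2 fun x _ => bot_mem_locAtDomain D x⟩,
    hD.isClosed_inverseTopology S⟩

/-- Enlarging a family of primes that defines `T` to all `P` with `T ⊆ D_P` does not change the
intersection. Thus `π_t` is always surjective here. -/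
theorem IsRadColonCoherent.piT_trace_invClosed (hD : IsRadColonCoherent D K)
    (T : Sublocalization D K) : piT K (hD.invClosed T.toSubalgebra).trace = T := by
  rw [piT_trace]
  refine Sublocalization.ext_mem fun x => ?_
  rw [mem_piS]
  constructor
  · obtain ⟨Δ, hΔ⟩ := T.exists_mem_iff
    intro h
    refine (hΔ x).2 fun P hP => h P (Set.mem_iInter₂.2 fun y hy => (hΔ y).1 hy P hP)
  · intro hx P hP
    exact Set.mem_iInter₂.1 hP x hx

theorem IsRadColonCoherent.continuous_piT (hD : IsRadColonCoherent D K) :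
    Continuous (piT K : InvClosed (tSpectrum D K) → Sublocalization D K) := by
  refine continuous_to_sublocalization fun F => ?_
  have : {Δ : InvClosed (tSpectrum D K) | ∀ x ∈ F, x ∈ (piT K Δ).toSubalgebra} =
      ⋂ x ∈ F, {Δ | Δ.1 ⊆ Subtype.val ⁻¹' locAtDomain D x} := by
    ext Δ
    simp only [mem_piT, Set.mem_ofPred_eq, Set.mem_iInter]
    rfl
  rw [this]
  refine isOpen_biInter_finset fun x _ => TopologicalSpace.isOpen_generateFrom_of_mem
    ⟨_, (hD.isCompact_isOpen x).2.preimage continuous_subtype_val,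
      isCompact_preimage_val isClosed_constructibleTopology_tSpectrum (hD.isCompact_isOpen x).2
        (hD.isCompact_isOpen x).1, rfl⟩

theorem IsRadColonCoherent.isHomeomorph_piT (hD : IsRadColonCoherent D K)
    (hinj : Function.Injective
      (piT K : InvClosed (tSpectrum D K) → Sublocalization D K)) :
    IsHomeomorph (piT K : InvClosed (tSpectrum D K) → Sublocalization D K) := by
  have htr (Δ : InvClosed (tSpectrum D K)) :
      (hD.invClosed (piT K Δ).toSubalgebra).trace = Δ := hinj (hD.piT_trace_invClosed _)
  let e : Sublocalization D K ≃ InvClosed (tSpectrum D K) :=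
    ⟨fun T => (hD.invClosed T.toSubalgebra).trace, piT K, hD.piT_trace_invClosed, htr⟩
  have he : Continuous e := by
    refine continuous_generateFrom_iff.2 ?_
    rintro _ ⟨V, hV, hVc, rfl⟩
    obtain ⟨U, hU, hUc, rfl⟩ := exists_isCompact_preimage_val hV hVc
    refine isOpen_iff_forall_mem_open.2 fun T hT => ?_
    -- Finitely many elements of `T` force the containment in `U`; all `T'` containing them form the
    -- required neighbourhood of `T`.
    obtain ⟨t, ht⟩ := exists_finset_iInter_subset
      (f := fun x : (T.toSubalgebra : Set K) => locAtDomain D x.1)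
      (isClosed_constructibleTopology_tSpectrum (K := K))
      (fun x => isClosed_constructibleTopology_of_isOpen (hD.isCompact_isOpen x.1).2
        (hD.isCompact_isOpen x.1).1) hU hUc (by
          rintro p ⟨hpQ, hp⟩
          exact hT (a := ⟨p, hpQ⟩)
            (Set.mem_iInter₂.2 fun x hx => Set.mem_iInter.1 hp ⟨x, hx⟩))
    classical
    refine ⟨_, fun T' hT' => ?_, isOpen_sublocalization (t.image Subtype.val), ?_⟩
    · intro p hp
      refine ht ⟨p.2, Set.mem_iInter₂.2 fun x hx => Set.mem_iInter₂.1 hp x.1 ?_⟩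
      exact hT' x.1 (Finset.mem_image_of_mem _ hx)
    · intro x hx
      obtain ⟨y, -, rfl⟩ := Finset.mem_image.1 hx
      exact y.2
  exact (Homeomorph.mk e.symm hD.continuous_piT he).isHomeomorph

end Main

end Subloc

theorem mainTheorem8 (D K : Type*) [CommRing D] [IsDomain D] [Field K] [Algebra D K]
    [IsFractionRing D K] (hD : Subloc.IsRadColonCoherent D K) :
    List.TFAE [
      IsHomeomorph
        (Subloc.piT K : Subloc.InvClosed (Subloc.tSpectrum D K) → Subloc.Sublocalization D K),
      Function.Injective
        (Subloc.piT K : Subloc.InvClosed (Subloc.tSpectrum D K) → Subloc.Sublocalization D K),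
      ∀ Δ Λ : Subloc.InvClosed (PrimeSpectrum D),
        Subloc.piS K (Subloc.spectralOpInvClosed K Δ) =
            Subloc.piS K (Subloc.spectralOpInvClosed K Λ) →
          Δ.1 ∩ Subloc.tSpectrum D K = Λ.1 ∩ Subloc.tSpectrum D K] := by
  have htrace (Δ Λ : Subloc.InvClosed (PrimeSpectrum D)) :
      (Δ.trace : Subloc.InvClosed (Subloc.tSpectrum D K)) = Λ.trace ↔
        Δ.1 ∩ Subloc.tSpectrum D K = Λ.1 ∩ Subloc.tSpectrum D K :=
    Subtype.ext_iff.trans (Subtype.preimage_val_eq_preimage_val_iff _ _ _) |>.trans (by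
      rw [Set.inter_comm, Set.inter_comm (Subloc.tSpectrum D K)])
  tfae_have 1 → 2 := fun h => h.injective
  tfae_have 2 → 1 := hD.isHomeomorph_piT
  tfae_have 2 → 3 := fun h Δ Λ hΔΛ =>
    (htrace Δ Λ).1 (h (by rwa [Subloc.piT_trace, Subloc.piT_trace]))
  tfae_have 3 → 2 := fun h Δ Λ hΔΛ => by
    -- Both sets are traces of their inverse closures in the spectrum, to which (iii) applies.
    rw [← Subloc.trace_closure Δ, ← Subloc.trace_closure Λ]
    refine (htrace _ _).2 (h _ _ ?_)
    rwa [← Subloc.piT_trace, ← Subloc.piT_trace, Subloc.trace_closure, Subloc.trace_closure]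
  tfae_finish
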